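/- All rings are commutative with $1$. For a ring $R$, let $U(R)$ be its group of units; a vector of a free module $R^m$ (for instance the module $\mathbb M_n(R)\cong R^{n^2}$ of $n\times n$ matrices) is unimodular if its coordinates generate the unit ideal, and $Um(\cdot)$ denotes the set of unimodular vectors. We use the following notions. - $R$ is a $(WSU)_2$ ring if for each $A\in Um(\mathbb M_2(R))$ there exists $N\in GL_2(R)$ such that $AN$ is symmetric. - For $a,b,c\in R$, let $\upsilon_{a,b,c}:U(R/Rac)\times U(R/Rbc)\to U(R/Rc)$ be the homomorphism that sends a pair to the product of the images in $U(R/Rc)$. $R$ is a $U_2$ ring if $\upsilon_{a,b,c}$ is surjective for all $(a,b)\in Um(R^2)$ and $c\in R$. - The stable range $sr(R)$ is the least $n\ge 1$ (or $\infty$ if there is none) such that for each $(a_1,\dots,a_{n+1})\in Um(R^{n+1})$ there exist $r_1,\dots,r_n\in R$ with $(a_1+r_1a_{n+1},\dots,a_n+r_na_{n+1})\in Um(R^n)$. - $R$ is a Hermite ring if each vector of $R^2$ is an $R$-multiple of a vector in $Um(R^2)$. - $R$ is an elementary divisor ring (EDR) if for every matrix $A$ with entries in $R$, of any size $m\times n$,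 there exist $M\in GL_m(R)$ and $N\in GL_n(R)$ such that all off-diagonal entries of $MAN$ are $0$ and each diagonal entry divides the next one. - A module is self-dual if it is isomorphic to its dual. **Theorem.** Let $R$ be a $(WSU)_2$ ring. Then the following properties hold. (1) For each $(a,b)\in Um(R^2)$ and $c\in R$, $\mathrm{Coker}(\upsilon_{a,b,c})$ is a Boolean group (all its elements have square $1$), i.e., $\{x^2\mid x\in U(R/Rc)\}\subset \mathrm{Im}(\upsilon_{a,b,c})$. (2) If $sr(R)\le 4$, then for each $d\in R$, every projective $R/Rd$-module of (constant) rank $1$ generated by $2$ elements is self-dual. (3) If each element of $R$ is the square of an element of $R$, then $R$ is a $U_2$ ring; if moreover $R$ is a Hermite ring, then $R$ is an EDR. The assumption that each element of $R$ is a square holds, for example, if $R$ is an integrally closed domain with an algebraically closed field of fractions, or if $R$ is a perfect ring of characteristic $2$. -/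

import Mathlib

namespace MatExt

/-- A vector `v` in the free module `R^ι` is unimodular: some linear form takes the value `1`
on it, i.e. its coordinates generate the unit ideal. -/
def IsUnimodular {R : Type*} [CommRing R] {ι : Type*} [Fintype ι] (v : ι → R) : Prop :=
  ∃ w : ι → R, ∑ i, w i * v i = 1

/-- An `n × n` matrix is unimodular when it is a unimodular element of the free module
of all `n × n` matrices, i.e. when its entries generate the unit ideal. -/
def IsUnimodularMatrix {R : Type*} [CommRing R] {n : ℕ} (A : Matrix (Fin n) (Fin n) R) : Prop :=
  IsUnimodular (fun p : Fin n × Fin n => A p.1 p.2)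

/-- `(WSU)_n` rings: each unimodular `n × n` matrix becomes symmetric after right
multiplication by a suitable invertible matrix. -/
def IsWSU (R : Type*) [CommRing R] (n : ℕ) : Prop :=
  ∀ A : Matrix (Fin n) (Fin n) R, IsUnimodularMatrix A →
    ∃ N : Matrix.GeneralLinearGroup (Fin n) R,
      (A * (N : Matrix (Fin n) (Fin n) R)).IsSymm

theorem span_mul_le {R : Type*} [CommRing R] (a c : R) :
    Ideal.span {a * c} ≤ Ideal.span {c} :=
  Ideal.span_singleton_le_span_singleton.mpr (Dvd.intro_left a rfl)

/-- The natural product homomorphism `U(R/Rac) × U(R/Rbc) → U(R/Rc)`. -/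
def upsilon {R : Type*} [CommRing R] (a b c : R) :
    (R ⧸ Ideal.span {a * c})ˣ × (R ⧸ Ideal.span {b * c})ˣ →* (R ⧸ Ideal.span {c})ˣ :=
  MonoidHom.coprod
    (Units.map (Ideal.Quotient.factor (span_mul_le a c)).toMonoidHom)
    (Units.map (Ideal.Quotient.factor (span_mul_le b c)).toMonoidHom)

/-- The cokernel of `upsilon a b c`. -/
abbrev CokerUpsilon {R : Type*} [CommRing R] (a b c : R) : Type _ :=
  (R ⧸ Ideal.span {c})ˣ ⧸ (upsilon a b c).range

/-- A Boolean group: every element has square `1`. -/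
def IsBooleanGroup (G : Type*) [Group G] : Prop :=
  ∀ g : G, g ^ 2 = 1

/-- `U_2` rings: `upsilon a b c` is surjective for each unimodular pair `(a, b)` and each `c`. -/
def IsUTwo (R : Type*) [CommRing R] : Prop :=
  ∀ a b c : R, IsUnimodular ![a, b] → Function.Surjective (upsilon a b c)

/-- The stable range condition in degree `n`: each unimodular vector of length `n + 1` can be
shortened to a unimodular vector of length `n` by adding multiples of the last coordinate
to the other ones. -/
def StableRangeCondition (R : Type*) [CommRing R] (n : ℕ) : Prop :=
  ∀ v : Fin (n + 1) → R, IsUnimodular v →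
    ∃ r : Fin n → R, IsUnimodular (fun i : Fin n => v i.castSucc + r i * v (Fin.last n))

/-- The stable range `sr(R)`: the least `n ≥ 1` for which the stable range condition holds
(`⊤` if there is none). -/
noncomputable def stableRange (R : Type*) [CommRing R] : ℕ∞ :=
  ⨅ (n : ℕ) (_ : 1 ≤ n ∧ StableRangeCondition R n), (n : ℕ∞)

/-- Hermite rings in the sense of Kaplansky: each vector of `R^2` is a multiple of a
unimodular one. -/
def IsHermiteRing (R : Type*) [CommRing R] : Prop :=
  ∀ x y : R, ∃ d a b : R, IsUnimodular ![a, b] ∧ x = d * a ∧ y = d * b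

/-- A matrix admits diagonal reduction: it is equivalent to a matrix whose off diagonal entries
are `0` and each of whose diagonal entries divides the next one. -/
def AdmitsDiagonalReduction {R : Type*} [CommRing R] {m n : ℕ}
    (A : Matrix (Fin m) (Fin n) R) : Prop :=
  ∃ (M : Matrix.GeneralLinearGroup (Fin m) R) (N : Matrix.GeneralLinearGroup (Fin n) R)
    (D : Matrix (Fin m) (Fin n) R),
    (M : Matrix (Fin m) (Fin m) R) * A * (N : Matrix (Fin n) (Fin n) R) = D ∧
    (∀ (i : Fin m) (j : Fin n), (i : ℕ) ≠ (j : ℕ) → D i j = 0) ∧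
    (∀ (k : ℕ) (hm : k + 1 < m) (hn : k + 1 < n),
      D ⟨k, Nat.lt_of_succ_lt hm⟩ ⟨k, Nat.lt_of_succ_lt hn⟩ ∣ D ⟨k + 1, hm⟩ ⟨k + 1, hn⟩)

/-- Elementary divisor rings: all matrices, of all sizes, admit diagonal reduction. -/
def IsElementaryDivisorRing (R : Type*) [CommRing R] : Prop :=
  ∀ (m n : ℕ) (A : Matrix (Fin m) (Fin n) R), AdmitsDiagonalReduction A

/-- A projective module of (constant) rank `1` that is generated by `2` elements. -/
structure IsRankOneTwoGenerated (S : Type*) [CommRing S] (P : Type*) [AddCommGroup P]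
    [Module S P] : Prop where
  projective : Module.Projective S P
  rank_one : ∀ p : PrimeSpectrum S, Module.rankAtStalk P p = 1
  two_generated : ∃ x y : P, Submodule.span S {x, y} = ⊤

/-- A module is self-dual when it is isomorphic to its dual. -/
def IsSelfDual (S : Type*) [CommRing S] (P : Type*) [AddCommGroup P] [Module S P] : Prop :=
  Nonempty (P ≃ₗ[S] Module.Dual S P)

end MatExt

open MatExt

namespace MatExt

/-! Everything rests on choosing the matrix to be symmetrized. For (1), lift a unit of `R/Rc` to `t`
and take `A = !![t, a*c; b*c, 0]`. If `A * N` is symmetric, then modulo `a*c` the first row of `N`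
is a multiple `l` of `(t, b*c)`, and `l` is a unit because `det N` is. Modulo `b*c` the first row of
`A * N` is `(v, 0)`, so `v` is a unit there. Since `v ≡ l * t ^ 2` modulo `c`, the class of `t ^ 2`
is a product of units of the two kinds (`IsWSU.exists_coprime_mul_sub_sq`). For (2), the module is
the image of an idempotent 2 × 2 matrix `E` and its dual is the image of `Eᵀ`. The rank makes `E`
unimodular, the stable range lifts it to a unimodular matrix over `R`, and symmetrizing the lift
identifies the two images (`nonempty_linearEquiv_of_isSymm`). For (3), if all elements are squares,
(1) gives `U_2`. Over a Hermite ring, `U_2` makes a bilinear value of every matrix divide all its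
entries (`IsUTwo.attainsContent`); such a value can be moved to the corner, and diagonal reduction
follows by induction. -/

theorem isUnimodular_pair_iff {R : Type*} [CommRing R] {a b : R} :
    IsUnimodular ![a, b] ↔ IsCoprime a b := by
  constructor
  · rintro ⟨w, hw⟩
    exact ⟨w 0, w 1, by simpa [Fin.sum_univ_two] using hw⟩
  · rintro ⟨p, q, h⟩
    exact ⟨![p, q], by simpa [Fin.sum_univ_two] using h⟩

/-! ### Squares in the image of `upsilon`. -/

theorem isUnit_mk_span_singleton_iff {R : Type*} [CommRing R] {t c : R} :
    IsUnit (Ideal.Quotient.mk (Ideal.span {c}) t) ↔ IsCoprime t c := by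
  rw [isUnit_iff_exists_inv]
  constructor
  · rintro ⟨s, hs⟩
    obtain ⟨s, rfl⟩ := Ideal.Quotient.mk_surjective s
    rw [← map_mul, ← map_one (Ideal.Quotient.mk _), Ideal.Quotient.eq,
      Ideal.mem_span_singleton] at hs
    obtain ⟨k, hk⟩ := hs
    exact ⟨s, -k, by linear_combination hk⟩
  · rintro ⟨p, q, h⟩
    refine ⟨Ideal.Quotient.mk _ p, ?_⟩
    rw [← map_mul, ← map_one (Ideal.Quotient.mk _), Ideal.Quotient.eq,
      Ideal.mem_span_singleton]
    exact ⟨-q, by linear_combination h⟩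

theorem upsilon_apply {R : Type*} [CommRing R] (a b c : R)
    (u : (R ⧸ Ideal.span {a * c})ˣ) (v : (R ⧸ Ideal.span {b * c})ˣ) :
    ((upsilon a b c (u, v) : (R ⧸ Ideal.span {c})ˣ) : R ⧸ Ideal.span {c}) =
      Ideal.Quotient.factor (span_mul_le a c) u * Ideal.Quotient.factor (span_mul_le b c) v :=
  rfl

theorem mem_range_upsilon_iff {R : Type*} [CommRing R] {a b c t : R}
    {x : (R ⧸ Ideal.span {c})ˣ} (hx : (x : R ⧸ Ideal.span {c}) = Ideal.Quotient.mk _ t) :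
    x ∈ (upsilon a b c).range ↔
      ∃ u v, IsCoprime u (a * c) ∧ IsCoprime v (b * c) ∧ c ∣ u * v - t := by
  constructor
  · rintro ⟨⟨u, v⟩, huv⟩
    obtain ⟨u', hu'⟩ := Ideal.Quotient.mk_surjective (u : R ⧸ Ideal.span {a * c})
    obtain ⟨v', hv'⟩ := Ideal.Quotient.mk_surjective (v : R ⧸ Ideal.span {b * c})
    refine ⟨u', v', isUnit_mk_span_singleton_iff.1 (hu' ▸ u.isUnit),
      isUnit_mk_span_singleton_iff.1 (hv' ▸ v.isUnit), ?_⟩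
    have h := congrArg Units.val huv
    rw [upsilon_apply, ← hu', ← hv', hx, Ideal.Quotient.factor_mk, Ideal.Quotient.factor_mk,
      ← map_mul, Ideal.Quotient.eq, Ideal.mem_span_singleton] at h
    exact h
  · rintro ⟨u, v, hu, hv, h⟩
    obtain ⟨u', hu'⟩ := isUnit_mk_span_singleton_iff.2 hu
    obtain ⟨v', hv'⟩ := isUnit_mk_span_singleton_iff.2 hv
    refine ⟨(u', v'), Units.ext ?_⟩
    rw [upsilon_apply, hu', hv', hx, Ideal.Quotient.factor_mk, Ideal.Quotient.factor_mk,
      ← map_mul, Ideal.Quotient.eq, Ideal.mem_span_singleton]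
    exact h

theorem IsWSU.exists_coprime_mul_sub_sq {R : Type*} [CommRing R] (hR : IsWSU R 2)
    {a b c t : R} (hab : IsCoprime a b) (ht : IsCoprime t c) :
    ∃ u v, IsCoprime u (a * c) ∧ IsCoprime v (b * c) ∧ c ∣ u * v - t ^ 2 := by
  obtain ⟨α, β, hαβ⟩ := hab
  obtain ⟨p, q, hpq⟩ := ht
  have hA : IsUnimodularMatrix !![t, a * c; b * c, 0] := by
    refine ⟨fun i => !![p, q * α; q * β, 0] i.1 i.2, ?_⟩
    simp only [Fintype.sum_prod_type, Fin.sum_univ_two, Matrix.of_apply, Matrix.cons_val_zero,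
      Matrix.cons_val_one]
    linear_combination hpq + q * c * hαβ
  obtain ⟨N, hN⟩ := hR _ hA
  obtain ⟨e, he⟩ := isUnit_iff_exists_inv.1 ((Matrix.isUnit_iff_isUnit_det _).1 N.isUnit)
  rw [Matrix.det_fin_two] at he
  have hs := hN.apply 0 1
  simp only [Matrix.mul_apply, Fin.sum_univ_two, Matrix.of_apply, Matrix.cons_val_zero,
      Matrix.cons_val_one] at hs
  set x := (N : Matrix (Fin 2) (Fin 2) R) 0 0
  set y := (N : Matrix (Fin 2) (Fin 2) R) 0 1
  set z := (N : Matrix (Fin 2) (Fin 2) R) 1 0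
  set w := (N : Matrix (Fin 2) (Fin 2) R) 1 1
  -- By symmetry `b*c*x ≡ t*y` modulo `a*c`, and `(t, b*c)` is unimodular there, with `p*t +
  -- q*β*(b*c) ≡ 1`. Hence `(x, y) ≡ l * (t, b*c)`.
  obtain ⟨l, hl⟩ : ∃ l, l = p * x + q * β * y := ⟨_, rfl⟩
  have h1 : l * t - x = a * c * (-q * (α * x + β * w)) := by
    linear_combination t * hl + x * hpq - q * β * hs + q * c * x * hαβ
  have h2 : l * (b * c) - y = a * c * (p * w - q * α * y) := by
    linear_combination b * c * hl + y * hpq + p * hs + q * c * y * hαβ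
  have hlu : IsCoprime l (a * c) := by
    refine ⟨(t * w - b * c * z) * e,
      -(-q * (α * x + β * w) * w - (p * w - q * α * y) * z) * e, ?_⟩
    linear_combination w * e * h1 - z * e * h2 + he
  obtain ⟨k, k', hk⟩ := hlu
  -- `u` is the inverse of `l` modulo `a*c`, and `v` is the corner entry of `A * N`.
  refine ⟨k, t * x + a * c * z, ⟨l, k', by linear_combination hk⟩, ?_, ?_⟩
  · refine ⟨(p * w - q * α * y) * e,
      (-p * x * z + q * α * x ^ 2 + q * β * (x * w - y * z)) * e, ?_⟩
    linear_combination (-p * z * e + q * α * x * e) * hs + he +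
      (x * w - y * z) * e * hpq + q * c * (x * w - y * z) * e * hαβ
  · refine ⟨-t ^ 2 * k' * a + k * a * z - k * t * a * (-q * (α * x + β * w)), ?_⟩
    linear_combination t ^ 2 * hk - k * t * h1

theorem IsWSU.sq_mem_range_upsilon {R : Type*} [CommRing R] (hR : IsWSU R 2)
    {a b c : R} (hab : IsUnimodular ![a, b]) (x : (R ⧸ Ideal.span {c})ˣ) :
    x ^ 2 ∈ (upsilon a b c).range := by
  obtain ⟨t, ht⟩ := Ideal.Quotient.mk_surjective (x : R ⧸ Ideal.span {c})
  rw [mem_range_upsilon_iff (t := t ^ 2) (by rw [Units.val_pow_eq_pow_val, ← ht, map_pow])]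
  exact hR.exists_coprime_mul_sub_sq (isUnimodular_pair_iff.1 hab)
    (isUnit_mk_span_singleton_iff.1 (ht ▸ x.isUnit))

theorem isBooleanGroup_cokerUpsilon {R : Type*} [CommRing R] {a b c : R}
    (h : ∀ x : (R ⧸ Ideal.span {c})ˣ, x ^ 2 ∈ (upsilon a b c).range) :
    IsBooleanGroup (CokerUpsilon a b c) := by
  intro g
  induction g using QuotientGroup.induction_on with
  | H x => exact (QuotientGroup.eq_one_iff (x ^ 2)).2 (h x)

theorem IsWSU.isUTwo {R : Type*} [CommRing R] (hR : IsWSU R 2)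
    (hsq : ∀ x : R, ∃ y : R, x = y ^ 2) : IsUTwo R := by
  intro a b c hab x
  obtain ⟨t, ht⟩ := Ideal.Quotient.mk_surjective (x : R ⧸ Ideal.span {c})
  obtain ⟨s, rfl⟩ := hsq t
  obtain ⟨y, hy⟩ : IsUnit (Ideal.Quotient.mk (Ideal.span {c}) s) := by
    rw [← isUnit_pow_iff two_ne_zero, ← map_pow, ht]
    exact x.isUnit
  have hx : y ^ 2 = x := Units.ext (by rw [Units.val_pow_eq_pow_val, hy, ← map_pow, ht])
  exact MonoidHom.mem_range.1 (hx ▸ hR.sq_mem_range_upsilon hab y)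

/-! ### Monotonicity of the stable range condition. -/

theorem StableRangeCondition.succ {R : Type*} [CommRing R] {n : ℕ}
    (h : StableRangeCondition R n) : StableRangeCondition R (n + 1) := by
  rintro v ⟨w, hw⟩
  rw [Fin.sum_univ_castSucc, Fin.sum_univ_castSucc] at hw
  -- Merging the last two coordinates into `z` gives a shorter unimodular vector. Of the multiples
  -- of `z` then added, only the part in the last coordinate has to be added to `v`; the other part
  -- is a multiple of a coordinate that is kept.
  set z := w (Fin.last n).castSucc * v (Fin.last n).castSucc +
    w (Fin.last (n + 1)) * v (Fin.last (n + 1)) with hz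
  obtain ⟨r, s, hs⟩ := h (Fin.snoc (fun i => v i.castSucc.castSucc) z)
    ⟨Fin.snoc (fun i => w i.castSucc.castSucc) 1, by
      rw [Fin.sum_univ_castSucc]; simp only [Fin.snoc_castSucc, Fin.snoc_last]
      refine Eq.trans ?_ hw; rw [hz]; ring⟩
  simp only [Fin.snoc_castSucc, Fin.snoc_last] at hs
  refine ⟨Fin.snoc (fun i => r i * w (Fin.last (n + 1))) 0,
    Fin.snoc s (w (Fin.last n).castSucc * ∑ i, s i * r i), ?_⟩
  rw [Fin.sum_univ_castSucc]
  simp only [Fin.snoc_castSucc, Fin.snoc_last]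
  rw [← hs, Finset.mul_sum, zero_mul, add_zero, Finset.sum_mul, ← Finset.sum_add_distrib]
  refine Finset.sum_congr rfl fun i _ => ?_
  rw [hz]; ring

theorem stableRangeCondition_of_stableRange_le {R : Type*} [CommRing R] {n : ℕ}
    (h : stableRange R ≤ n) : StableRangeCondition R n := by
  obtain ⟨m, hm, hmn⟩ : ∃ m, StableRangeCondition R m ∧ m ≤ n := by
    by_contra! hc
    have : ((n + 1 : ℕ) : ℕ∞) ≤ stableRange R :=
      le_iInf₂ fun m hm => Nat.cast_le.2 (hc m hm.2)
    exact absurd (Nat.cast_le.1 (this.trans h)) (by omega)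
  exact Nat.le_induction hm (fun _ _ ih => ih.succ) n hmn

/-! ### Bordered matrices, and diagonal reduction over Hermite `U_2` rings. -/

section Diagonal

open Matrix

/-- The matrix with corner `a`, first row `(a, r)`, first column `(a, c)` and remaining
block `M`. -/
def bordered {α : Type*} {m n : ℕ} (a : α) (r : Fin n → α) (c : Fin m → α)
    (M : Matrix (Fin m) (Fin n) α) :
    Matrix (Fin (m + 1)) (Fin (n + 1)) α :=
  Matrix.of (Fin.cons (Fin.cons a r) fun i => Fin.cons (c i) (M i))

section bordered

variable {α : Type*} {m n : ℕ} (a : α) (r : Fin n → α) (c : Fin m → α)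
  (M : Matrix (Fin m) (Fin n) α)

@[simp] theorem bordered_zero_zero : bordered a r c M 0 0 = a := rfl
@[simp] theorem bordered_zero_succ (j : Fin n) : bordered a r c M 0 j.succ = r j := rfl
@[simp] theorem bordered_succ_zero (i : Fin m) : bordered a r c M i.succ 0 = c i := rfl
@[simp] theorem bordered_succ_succ (i : Fin m) (j : Fin n) :
    bordered a r c M i.succ j.succ = M i j := rfl

theorem bordered_eta (A : Matrix (Fin (m + 1)) (Fin (n + 1)) α) :
    bordered (A 0 0) (fun j => A 0 j.succ) (fun i => A i.succ 0)
      (A.submatrix Fin.succ Fin.succ) = A := by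
  ext i j
  refine Fin.cases ?_ (fun i => ?_) i <;> refine Fin.cases ?_ (fun j => ?_) j <;> rfl

end bordered

variable {R : Type*} [CommRing R] {m n : ℕ}

/-- Some value `x ⬝ A y` of the bilinear form of `A` divides all entries of `A`. -/
def AttainsContent (A : Matrix (Fin m) (Fin n) R) : Prop :=
  ∃ (x : Fin m → R) (y : Fin n → R), ∀ i j, x ⬝ᵥ A *ᵥ y ∣ A i j

theorem dvd_dotProduct {d : R} {v : Fin n → R} (w : Fin n → R) (h : ∀ i, d ∣ v i) :
    d ∣ w ⬝ᵥ v :=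
  Finset.dvd_sum fun i _ => (h i).mul_left _

theorem dvd_mul_mul {d : R} {A : Matrix (Fin m) (Fin n) R} (M : Matrix (Fin m) (Fin m) R)
    (N : Matrix (Fin n) (Fin n) R) (h : ∀ i j, d ∣ A i j) (i : Fin m) (j : Fin n) :
    d ∣ (M * A * N) i j := by
  simp only [Matrix.mul_apply]
  exact Finset.dvd_sum fun k _ => (Finset.dvd_sum fun l _ => (h l k).mul_left _).mul_right _

theorem AttainsContent.transpose {A : Matrix (Fin m) (Fin n) R} (h : AttainsContent A) :
    AttainsContent Aᵀ := by
  obtain ⟨x, y, hxy⟩ := h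
  refine ⟨y, x, fun i j => ?_⟩
  rw [mulVec_transpose, dotProduct_comm, ← dotProduct_mulVec]
  exact hxy j i

theorem AttainsContent.of_mul_right {A : Matrix (Fin m) (Fin n) R} (N : GL (Fin n) R)
    (h : AttainsContent (A * (N : Matrix (Fin n) (Fin n) R))) : AttainsContent A := by
  obtain ⟨x, y, hxy⟩ := h
  refine ⟨x, (N : Matrix (Fin n) (Fin n) R) *ᵥ y, fun i j => ?_⟩
  have := dvd_mul_mul 1 ((N⁻¹ : GL (Fin n) R) : Matrix (Fin n) (Fin n) R) hxy i j
  rwa [Matrix.one_mul, Matrix.mul_assoc, ← Units.val_mul, mul_inv_cancel, Units.val_one,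
    Matrix.mul_one, ← mulVec_mulVec] at this

section bordered

variable (a : R) (r : Fin n → R) (c : Fin m → R) (M : Matrix (Fin m) (Fin n) R)

theorem bordered_mul_bordered {l : ℕ} (a' : R) (r' : Fin l → R) (c' : Fin n → R)
    (M' : Matrix (Fin n) (Fin l) R) :
    bordered a r c M * bordered a' r' c' M' =
      bordered (a * a' + r ⬝ᵥ c') (a • r' + r ᵥ* M') (a' • c + M *ᵥ c')
        (vecMulVec c r' + M * M') := by
  ext i j
  refine Fin.cases ?_ (fun i => ?_) i <;> refine Fin.cases ?_ (fun j => ?_) j <;>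
    simp [Matrix.mul_apply, Fin.sum_univ_succ, dotProduct, vecMul, mulVec, vecMulVec_apply,
      mul_comm]

theorem det_bordered_zero_row (c : Fin n → R) (M : Matrix (Fin n) (Fin n) R) :
    (bordered a 0 c M).det = a * M.det := by
  rw [det_succ_row_zero, Fin.sum_univ_succ]
  simp
  rfl

theorem det_bordered_zero_column (M : Matrix (Fin n) (Fin n) R) :
    (bordered a r 0 M).det = a * M.det := by
  rw [det_succ_column_zero, Fin.sum_univ_succ]
  simp
  rfl

end bordered

/-- Every vector of `R ^ (n + 1)` over a Hermite ring is a multiple of the first row of an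
invertible matrix. -/
theorem IsHermiteRing.exists_eq_smul_row (hR : IsHermiteRing R) :
    ∀ {n : ℕ} (v : Fin (n + 1) → R), ∃ (g : R) (Q : Matrix (Fin (n + 1)) (Fin (n + 1)) R),
      IsUnit Q.det ∧ v = g • Q 0
  | 0, v => ⟨v 0, 1, by simp, by ext i; rw [Fin.fin_one_eq_zero i]; simp⟩
  | n + 1, v => by
    obtain ⟨h, Q, hQ, hv⟩ := hR.exists_eq_smul_row (Fin.tail v)
    obtain ⟨d, a, b, hab, h0, rfl⟩ := hR (v 0) h
    obtain ⟨α, β, hαβ⟩ := isUnimodular_pair_iff.1 hab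
    -- The border is chosen so that expansion along the first column gives `(α*a + β*b) * det Q =
    -- det Q`.
    refine ⟨d, bordered a (b • Q 0) (Pi.single 0 (-β)) (Q.updateRow 0 (α • Q 0)), ?_, ?_⟩
    · convert hQ using 1
      rw [det_succ_column_zero, Fin.sum_univ_succ, Fin.sum_univ_succ]
      have h1 : (bordered a (b • Q 0) (Pi.single 0 (-β)) (Q.updateRow 0 (α • Q 0))).submatrix
          (Fin.succAbove 0) Fin.succ = Q.updateRow 0 (α • Q 0) := rfl
      have h2 : (bordered a (b • Q 0) (Pi.single 0 (-β)) (Q.updateRow 0 (α • Q 0))).submatrix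
          (Fin.succAbove (Fin.succ 0)) Fin.succ = Q.updateRow 0 (b • Q 0) := by
        ext i j
        refine Fin.cases ?_ (fun i => ?_) i
        · simp
        · simp
      rw [h1, h2, det_updateRow_smul, det_updateRow_smul, updateRow_eq_self]
      simp only [Fin.val_zero, Fin.val_succ, bordered_zero_zero, bordered_succ_zero, Pi.single_eq_same,
        ne_eq, Fin.succ_ne_zero, not_false_eq_true, Pi.single_eq_of_ne, mul_zero, zero_mul,
        Finset.sum_const_zero]
      linear_combination Q.det * hαβ
    · ext j
      refine Fin.cases ?_ (fun j => ?_) j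
      · exact h0
      · have := congrFun hv j
        simp only [Fin.tail] at this
        rw [this]
        simp [mul_assoc]

theorem IsHermiteRing.exists_generalLinearGroup (hR : IsHermiteRing R) (v : Fin (n + 1) → R) :
    ∃ (g : R) (N : GL (Fin (n + 1)) R),
      v = g • (N : Matrix (Fin (n + 1)) (Fin (n + 1)) R) 0 := by
  obtain ⟨g, Q, hQ, hv⟩ := hR.exists_eq_smul_row v
  obtain ⟨N, rfl⟩ := (isUnit_iff_isUnit_det Q).2 hQ
  exact ⟨g, N, hv⟩

theorem IsHermiteRing.exists_vecMul_eq_single (hR : IsHermiteRing R) (v : Fin (n + 1) → R) :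
    ∃ (g : R) (N : GL (Fin (n + 1)) R),
      v ᵥ* (N : Matrix (Fin (n + 1)) (Fin (n + 1)) R) = Pi.single 0 g := by
  obtain ⟨g, N, rfl⟩ := hR.exists_generalLinearGroup v
  refine ⟨g, N⁻¹, ?_⟩
  have h : (N : Matrix (Fin (n + 1)) (Fin (n + 1)) R) 0 = Pi.single 0 1 ᵥ* N.val :=
    (single_one_vecMul 0 N.val).symm
  rw [h, smul_vecMul, vecMul_vecMul, ← Units.val_mul, mul_inv_cancel, Units.val_one, vecMul_one,
    ← Pi.single_smul, smul_eq_mul, mul_one]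

theorem IsUTwo.exists_coprime_mul_sub (hR : IsUTwo R) {a b c d : R} (hac : IsCoprime a c)
    (hbd : IsCoprime b d) :
    ∃ u v, IsCoprime u (a * d) ∧ IsCoprime v (c * d) ∧ d ∣ u * v - b := by
  obtain ⟨x, hx⟩ := isUnit_mk_span_singleton_iff.2 hbd
  exact (mem_range_upsilon_iff hx).1
    (MonoidHom.mem_range.2 (hR a c d (isUnimodular_pair_iff.2 hac) x))

/-- Kaplansky's condition: the two elements are the entries of `(p, q)` times `!![b, d*a; d*c, 0]`,
up to order. Factor `b ≡ u * v` modulo `d` by `U_2`; the inverse `k` of `v` modulo `c*d` serves as a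
first guess for `p`. -/
theorem IsUTwo.exists_isCoprime_row (hU : IsUTwo R) (hH : IsHermiteRing R) {a b c d : R}
    (hac : IsCoprime a c) (hbd : IsCoprime b d) :
    ∃ p q, IsCoprime (p * (d * a)) (p * b + q * (d * c)) := by
  obtain ⟨u, v, hu, ⟨k, l, hkl⟩, s, hs⟩ := hU.exists_coprime_mul_sub hac hbd
  obtain ⟨α, γ, hαγ⟩ := hac
  -- The second entry is chosen so that `g * (p*b + q*(d*c)) ≡ u` modulo `a*d`. Dividing out `g`
  -- makes `p` and `q` coprime, so `p` is coprime to `p*b + q*(d*c)`.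
  obtain ⟨g, p, q, hpq, hp, hq⟩ := hH k (γ * (u * c * l + k * s))
  rw [isUnimodular_pair_iff] at hpq
  have hpc : IsCoprime p (d * c) := ⟨g * v, l, by linear_combination hkl - v * hp⟩
  have hg : g * (p * b + q * (d * c)) = u + a * d * (-α * (u * c * l + k * s)) := by
    linear_combination -b * hp - d * c * hq - k * hs + u * hkl + d * (u * c * l + k * s) * hαγ
  refine ⟨p, q, IsCoprime.mul_left ?_ ?_⟩
  · rw [add_comm, mul_comm p b]
    exact (hpq.mul_right hpc).add_mul_left_right b |> fun h => by rwa [mul_comm p b] at h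
  · refine IsCoprime.symm (IsCoprime.of_mul_left_right (x := g) ?_)
    rw [hg, mul_comm d a]
    exact hu.add_mul_left_left _

theorem attainsContent_two_two (hU : IsUTwo R) (hH : IsHermiteRing R)
    (A : Matrix (Fin 2) (Fin 2) R) : AttainsContent A := by
  obtain ⟨g, N, hA⟩ : ∃ (g : R) (N : GL (Fin 2) R), A 1 ᵥ* N.val = Pi.single 0 g :=
    hH.exists_vecMul_eq_single (A 1)
  refine AttainsContent.of_mul_right N ?_
  set B := A * (N : Matrix (Fin 2) (Fin 2) R)
  have hB : B 1 1 = 0 := (congrFun hA 1).trans (by simp)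
  obtain ⟨e, a, c, hac, ha, hc⟩ := hH (B 0 1) (B 1 0)
  obtain ⟨f, d, b, hdb, hd, hb⟩ := hH e (B 0 0)
  obtain ⟨p, q, y, z, hyz⟩ := hU.exists_isCoprime_row hH (isUnimodular_pair_iff.1 hac)
    (isUnimodular_pair_iff.1 hdb).symm
  have key : ![p, q] ⬝ᵥ B *ᵥ ![z, y] = f := by
    simp only [dotProduct, mulVec, Fin.sum_univ_two, cons_val_zero, cons_val_one, hB, ha, hc, hb,
      hd]
    linear_combination f * hyz
  refine ⟨![p, q], ![z, y], fun i j => ?_⟩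
  rw [key]
  fin_cases i <;> fin_cases j
  · exact ⟨b, hb⟩
  · exact ⟨d * a, by simp [ha, hd, mul_assoc]⟩
  · exact ⟨d * c, by simp [hc, hd, mul_assoc]⟩
  · exact ⟨0, by simp [hB]⟩

/-- A common divisor of the entries of the row `x ᵥ* A'`, where `A'` consists of the lower rows,
divides `x ⬝ᵥ A' *ᵥ y` and so all of `A'`. That single row can therefore stand for `A'`, leaving a
matrix with two rows. -/
theorem AttainsContent.of_submatrix_succ {A : Matrix (Fin (m + 1)) (Fin n) R}
    (h : AttainsContent (A.submatrix Fin.succ id))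
    (h2 : ∀ B : Matrix (Fin 2) (Fin n) R, AttainsContent B) : AttainsContent A := by
  obtain ⟨x, y, hxy⟩ := h
  obtain ⟨p, z, hpz⟩ := h2 (Matrix.of ![A 0, x ᵥ* A.submatrix Fin.succ id])
  have key : (Fin.cons (p 0) (p 1 • x) : Fin (m + 1) → R) ⬝ᵥ A *ᵥ z =
      p ⬝ᵥ (Matrix.of ![A 0, x ᵥ* A.submatrix Fin.succ id]) *ᵥ z := by
    have h1 : (p 1 • x) ⬝ᵥ A.submatrix Fin.succ id *ᵥ z =
        p 1 * ((x ᵥ* A.submatrix Fin.succ id) ⬝ᵥ z) := by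
      rw [smul_dotProduct, dotProduct_mulVec, smul_eq_mul]
    rw [dotProduct, Fin.sum_univ_succ, dotProduct, Fin.sum_univ_two]
    exact congrArg (p 0 * (A 0 ⬝ᵥ z) + ·) h1
  refine ⟨Fin.cons (p 0) (p 1 • x), z, fun i j => ?_⟩
  rw [key]
  refine Fin.cases (hpz 0 j) (fun i => ?_) i
  refine dvd_trans ?_ (hxy i j)
  rw [dotProduct_mulVec x, dotProduct_comm (x ᵥ* _)]
  exact dvd_dotProduct y (hpz 1)

theorem attainsContent_one (hH : IsHermiteRing R) (A : Matrix (Fin 1) (Fin n) R) :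
    AttainsContent A := by
  cases n with
  | zero => exact ⟨0, 0, fun _ j => j.elim0⟩
  | succ n =>
    obtain ⟨g, N, hA⟩ := hH.exists_vecMul_eq_single (A 0)
    refine AttainsContent.of_mul_right N ⟨Pi.single 0 1, Pi.single 0 1, fun i j => ?_⟩
    have h : ∀ j, (A * (N : Matrix (Fin (n + 1)) (Fin (n + 1)) R)) 0 j =
      (Pi.single 0 g : Fin (n + 1) → R) j := congrFun hA
    rw [Fin.fin_one_eq_zero i, mulVec_single_one, single_one_dotProduct, col_apply, h, h]
    refine Fin.cases dvd_rfl (fun j => ?_) j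
    simp

theorem attainsContent_of_two (hH : IsHermiteRing R)
    (h2 : ∀ B : Matrix (Fin 2) (Fin n) R, AttainsContent B) :
    ∀ {m : ℕ} (A : Matrix (Fin m) (Fin n) R), AttainsContent A
  | 0, _ => ⟨0, 0, fun i => i.elim0⟩
  | 1, A => attainsContent_one hH A
  | _ + 2, _ => .of_submatrix_succ (attainsContent_of_two hH h2 _) h2

theorem IsUTwo.attainsContent (hU : IsUTwo R) (hH : IsHermiteRing R)
    (A : Matrix (Fin m) (Fin n) R) : AttainsContent A :=
  -- Rows are reduced to two, and then, after transposing, columns are reduced to two.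
  attainsContent_of_two hH (fun B => (attainsContent_of_two hH
    (attainsContent_two_two hU hH) Bᵀ).transpose) A

/-! ### From an attained content to diagonal form. -/

theorem AdmitsDiagonalReduction.of_mul_mul {A : Matrix (Fin m) (Fin n) R} (M : GL (Fin m) R)
    (N : GL (Fin n) R) (h : AdmitsDiagonalReduction (M.val * A * N.val)) :
    AdmitsDiagonalReduction A := by
  obtain ⟨M', N', D, hD, h1, h2⟩ := h
  refine ⟨M' * M, N * N', D, ?_, h1, h2⟩
  rw [← hD, Units.val_mul, Units.val_mul]
  simp only [Matrix.mul_assoc]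

/-- A matrix over a Hermite ring that attains its content is equivalent to one whose corner
divides all entries. -/
theorem AttainsContent.exists_corner_dvd (hH : IsHermiteRing R)
    {A : Matrix (Fin (m + 1)) (Fin (n + 1)) R} (hA : AttainsContent A) :
    ∃ (M : GL (Fin (m + 1)) R) (N : GL (Fin (n + 1)) R),
      ∀ i j, (M.val * A * N.val) 0 0 ∣ (M.val * A * N.val) i j := by
  obtain ⟨x, y, hxy⟩ := hA
  obtain ⟨g, M, rfl⟩ := hH.exists_generalLinearGroup x
  obtain ⟨h, N, rfl⟩ := hH.exists_generalLinearGroup y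
  refine ⟨M, ⟨N.valᵀ, N⁻¹.valᵀ, ?_, ?_⟩, dvd_mul_mul _ _ fun i j => dvd_trans ?_ (hxy i j)⟩
  · rw [← transpose_mul, ← Units.val_mul, inv_mul_cancel, Units.val_one, transpose_one]
  · rw [← transpose_mul, ← Units.val_mul, mul_inv_cancel, Units.val_one, transpose_one]
  · have : (M.val * A * N.valᵀ) 0 0 = M.val 0 ⬝ᵥ A *ᵥ N.val 0 := by
      rw [dotProduct_mulVec]; rfl
    rw [smul_dotProduct, mulVec_smul, dotProduct_smul, ← this]
    exact ((dvd_refl _).mul_left _).mul_left _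

theorem AdmitsDiagonalReduction.bordered_zero_zero {d : R} {A : Matrix (Fin m) (Fin n) R}
    (hd : ∀ i j, d ∣ A i j) (h : AdmitsDiagonalReduction A) :
    AdmitsDiagonalReduction (bordered d 0 0 A) := by
  obtain ⟨M, N, D, rfl, h1, h2⟩ := h
  obtain ⟨M', hM'⟩ : IsUnit (bordered 1 0 0 M.val) := by
    rw [isUnit_iff_isUnit_det, det_bordered_zero_row, one_mul, ← isUnit_iff_isUnit_det]
    exact M.isUnit
  obtain ⟨N', hN'⟩ : IsUnit (bordered 1 0 0 N.val) := by
    rw [isUnit_iff_isUnit_det, det_bordered_zero_row, one_mul, ← isUnit_iff_isUnit_det]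
    exact N.isUnit
  refine ⟨M', N', bordered d 0 0 (M.val * A * N.val), ?_, fun i j => ?_, ?_⟩
  · rw [hM', hN', bordered_mul_bordered, bordered_mul_bordered]
    simp
  · refine Fin.cases ?_ (fun i => ?_) i <;> refine Fin.cases ?_ (fun j => ?_) j <;> intro hij
    · exact absurd rfl hij
    · rfl
    · rfl
    · exact h1 i j fun h => hij (by simpa using h)
  · rintro (_ | k) hm hn
    · exact dvd_mul_mul M.val N.val hd ⟨0, by omega⟩ ⟨0, by omega⟩
    · exact h2 k (by omega) (by omega)

theorem AdmitsDiagonalReduction.of_corner_dvd {A : Matrix (Fin (m + 1)) (Fin (n + 1)) R}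
    (hA : ∀ i j, A 0 0 ∣ A i j)
    (h : ∀ B : Matrix (Fin m) (Fin n) R, AdmitsDiagonalReduction B) :
    AdmitsDiagonalReduction A := by
  choose c hc using fun i : Fin m => hA i.succ 0
  choose r hr using fun j : Fin n => hA 0 j.succ
  obtain ⟨M, hM⟩ : IsUnit (bordered (1 : R) 0 (-c) (1 : Matrix (Fin m) (Fin m) R)) := by
    rw [isUnit_iff_isUnit_det, det_bordered_zero_row]; simp
  obtain ⟨N, hN⟩ : IsUnit (bordered (1 : R) (-r) 0 (1 : Matrix (Fin n) (Fin n) R)) := by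
    rw [isUnit_iff_isUnit_det, det_bordered_zero_column]; simp
  refine .of_mul_mul M N ?_
  have hc' : (fun i : Fin m => A i.succ 0) = A 0 0 • c := funext hc
  have hr' : (fun j : Fin n => A 0 j.succ) = A 0 0 • r := funext hr
  have key : M.val * A * N.val =
      bordered (A 0 0) 0 0 (A.submatrix Fin.succ Fin.succ - A 0 0 • vecMulVec c r) := by
    nth_rewrite 1 [← bordered_eta A]
    rw [hM, hN, bordered_mul_bordered, bordered_mul_bordered, hc', hr']
    congr 1
    · simp
    · simp
    · simp
    · ext i j
      simp [vecMulVec_apply]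
      ring
  rw [key]
  refine .bordered_zero_zero (fun i j => ?_) (h _)
  exact dvd_sub (hA _ _) (dvd_mul_right _ _)

theorem IsUTwo.isElementaryDivisorRing (hU : IsUTwo R) (hH : IsHermiteRing R) :
    IsElementaryDivisorRing R
  | 0, _, A => ⟨1, 1, A, by simp, fun i => i.elim0, fun _ hm => absurd hm (by omega)⟩
  | _ + 1, 0, A => ⟨1, 1, A, by simp, fun _ j => j.elim0, fun _ _ hn => absurd hn (by omega)⟩
  | _ + 1, _ + 1, A => by
    obtain ⟨M, N, h⟩ := (hU.attainsContent hH A).exists_corner_dvd hH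
    exact .of_mul_mul M N (.of_corner_dvd h (hU.isElementaryDivisorRing hH _ _))

end Diagonal

/-! ### Self-duality of rank one projective modules. -/

section SelfDual

open Matrix

/-- If an idempotent matrix `E = G F` becomes symmetric after right multiplication by an
invertible matrix, then the images of `E` and `Eᵀ` are isomorphic. -/
theorem nonempty_linearEquiv_of_isSymm {S P Q : Type*} [CommRing S] [AddCommGroup P]
    [AddCommGroup Q] [Module S P] [Module S Q] {n : ℕ} {E : Matrix (Fin n) (Fin n) S}
    {f : (Fin n → S) →ₗ[S] P} {g : P →ₗ[S] (Fin n → S)}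
    {f' : (Fin n → S) →ₗ[S] Q} {g' : Q →ₗ[S] (Fin n → S)}
    (hfg : ∀ p, f (g p) = p) (hgf : ∀ v, g (f v) = E *ᵥ v)
    (hfg' : ∀ q, f' (g' q) = q) (hgf' : ∀ v, g' (f' v) = Eᵀ *ᵥ v)
    {N N' : Matrix (Fin n) (Fin n) S} (hN : N * N' = 1) (hE : (E * N).IsSymm) :
    Nonempty (P ≃ₗ[S] Q) := by
  have hN' : N' * N = 1 := mul_eq_one_comm.1 hN
  have hs : Nᵀ * Eᵀ = E * N := by rw [← transpose_mul]; exact hE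
  have hT : N'ᵀ * Nᵀ = 1 := by rw [← transpose_mul, hN, transpose_one]
  -- Thus `N'ᵀ` carries the image of `E` into that of `Eᵀ`, while `Nᵀ * Eᵀ = E * N` shows that `Nᵀ`
  -- goes back.
  have hs' : N'ᵀ * E = Eᵀ * N' := by
    calc N'ᵀ * E = N'ᵀ * (E * N) * N' := by
          rw [Matrix.mul_assoc, Matrix.mul_assoc, hN, Matrix.mul_one]
      _ = N'ᵀ * Nᵀ * Eᵀ * N' := by rw [← hs, ← Matrix.mul_assoc N'ᵀ]
      _ = Eᵀ * N' := by rw [hT, Matrix.one_mul]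
  have hEg : ∀ p, E *ᵥ g p = g p := fun p => by rw [← hgf, hfg]
  have hEg' : ∀ q, Eᵀ *ᵥ g' q = g' q := fun q => by rw [← hgf', hfg']
  have hEE : ∀ v, E *ᵥ (E *ᵥ v) = E *ᵥ v := fun v => by rw [← hgf v, hEg]
  have hEE' : ∀ v, Eᵀ *ᵥ (Eᵀ *ᵥ v) = Eᵀ *ᵥ v := fun v => by rw [← hgf' v, hEg']
  refine ⟨LinearEquiv.ofLinearMap (f' ∘ₗ mulVecLin N'ᵀ ∘ₗ g) (f ∘ₗ mulVecLin Nᵀ ∘ₗ g') ?_ ?_⟩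
  · ext1 q
    simp only [LinearMap.comp_apply, mulVecLin_apply, LinearMap.id_apply]
    rw [hgf, ← hEg' q, mulVec_mulVec _ Nᵀ, hs, ← mulVec_mulVec _ E, hEE, mulVec_mulVec _ E, ← hs,
      mulVec_mulVec, ← Matrix.mul_assoc, hT, Matrix.one_mul, hEg', hfg']
  · ext1 p
    simp only [LinearMap.comp_apply, mulVecLin_apply, LinearMap.id_apply]
    rw [hgf', ← hEg p, mulVec_mulVec _ N'ᵀ, hs', ← mulVec_mulVec _ Eᵀ, hEE', mulVec_mulVec _ Eᵀ,
      mulVec_mulVec, ← Matrix.mul_assoc, hs, Matrix.mul_assoc E, hN, Matrix.mul_one, hEg, hfg]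

/-- A rank one projective module with two generators is the image of a unimodular idempotent. -/
theorem IsRankOneTwoGenerated.exists_coordinates {S P : Type*} [CommRing S] [AddCommGroup P]
    [Module S P] (hP : IsRankOneTwoGenerated S P) :
    ∃ (x : Fin 2 → P) (g : P →ₗ[S] (Fin 2 → S)), (∀ p, ∑ i, g p i • x i = p) ∧
      IsUnimodularMatrix (Matrix.of fun i j => g (x j) i) := by
  obtain ⟨hproj, hrank, a, b, hab⟩ := hP
  have hsurj : Function.Surjective (Fintype.linearCombination S ![a, b]) := by
    rw [← LinearMap.range_eq_top, Fintype.range_linearCombination, ← hab]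
    simp [Set.pair_comm]
  obtain ⟨g, hg⟩ := LinearMap.exists_rightInverse_of_surjective _ (LinearMap.range_eq_top.2 hsurj)
  have hg' : ∀ p, ∑ i, g p i • ![a, b] i = p := fun p => LinearMap.congr_fun hg p
  refine ⟨![a, b], g, hg', ?_⟩
  have : Module.Finite S P := Module.Finite.of_surjective _ hsurj
  let I := Ideal.span (Set.range fun p : Fin 2 × Fin 2 => g (![a, b] p.2) p.1)
  have hI : I = ⊤ := by
    by_contra hI
    obtain ⟨m, hm, hIm⟩ := Ideal.exists_le_maximal I hI
    -- Nakayama: if `P = I P`, some `r ≡ 1` modulo `I` kills `P`. As `r` lies outside `m`, the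
    -- localization of `P` at `m` vanishes, against rank one.
    have hle : (⊤ : Submodule S P) ≤ I • (⊤ : Submodule S P) := by
      have key : ∀ p i, g p i ∈ I := by
        intro p i
        rw [← hg' p, map_sum, Finset.sum_apply]
        refine I.sum_mem fun j _ => ?_
        rw [map_smul, Pi.smul_apply]
        exact I.smul_mem _ (Ideal.subset_span ⟨(i, j), rfl⟩)
      intro p _
      rw [← hg' p]
      exact Submodule.sum_mem _ fun i _ => Submodule.smul_mem_smul (key p i) trivial
    obtain ⟨r, hr, hrP⟩ := Submodule.exists_sub_one_mem_and_smul_eq_zero_of_fg_of_le_smul I ⊤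
      Module.Finite.fg_top hle
    have hrm : r ∈ m.primeCompl := fun h =>
      hm.ne_top (m.eq_top_iff_one.2 (by simpa using m.sub_mem h (hIm hr)))
    have hsub : Subsingleton (LocalizedModule m.primeCompl P) :=
      LocalizedModule.subsingleton_iff.2 fun p => ⟨r, hrm, hrP p trivial⟩
    have h1 := hrank ⟨m, hm.isPrime⟩
    have h0 : Module.rankAtStalk P (⟨m, hm.isPrime⟩ : PrimeSpectrum S) = 0 :=
      Module.finrank_zero_of_subsingleton
    omega
  obtain ⟨w, hw⟩ := (Ideal.mem_span_range_iff_exists_fun (R := S)).1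
    ((Ideal.eq_top_iff_one _).1 hI)
  exact ⟨w, hw⟩

/-- A unimodular `2 × 2` matrix modulo `d` lifts to a unimodular matrix if `sr R ≤ 4`. -/
theorem StableRangeCondition.exists_unimodular_lift {R : Type*} [CommRing R]
    (h : StableRangeCondition R 4) {d : R} {E : Matrix (Fin 2) (Fin 2) (R ⧸ Ideal.span {d})}
    (hE : IsUnimodularMatrix E) :
    ∃ A : Matrix (Fin 2) (Fin 2) R, IsUnimodularMatrix A ∧
      A.map (Ideal.Quotient.mk (Ideal.span {d})) = E := by
  obtain ⟨w, hw⟩ := hE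
  choose E' hE' using fun p : Fin 2 × Fin 2 => Ideal.Quotient.mk_surjective (E p.1 p.2)
  choose w' hw' using fun p : Fin 2 × Fin 2 => Ideal.Quotient.mk_surjective (w p)
  have hmem : ∑ p, w' p * E' p - 1 ∈ Ideal.span {d} := by
    rw [← Ideal.Quotient.eq, map_sum, map_one, ← hw]
    exact Finset.sum_congr rfl fun p _ => by rw [map_mul, hE', hw']
  obtain ⟨k, hk⟩ := Ideal.mem_span_singleton.1 hmem
  let σ : Fin 4 ≃ Fin 2 × Fin 2 := (finProdFinEquiv (m := 2) (n := 2)).symm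
  -- The four lifted entries together with `d` form a unimodular 5-vector; this is where the bound 4
  -- comes from.
  obtain ⟨r, s, hs⟩ := h (Fin.snoc (fun i => E' (σ i)) d) ⟨Fin.snoc (fun i => w' (σ i)) (-k), by
    rw [Fin.sum_univ_castSucc]
    simp only [Fin.snoc_castSucc, Fin.snoc_last]
    rw [σ.sum_comp fun p => w' p * E' p]
    linear_combination hk⟩
  simp only [Fin.snoc_castSucc, Fin.snoc_last] at hs
  refine ⟨Matrix.of fun i j => E' (i, j) + r (σ.symm (i, j)) * d, ⟨fun p => s (σ.symm p), ?_⟩, ?_⟩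
  · rw [← hs, ← σ.sum_comp]
    simp
  · ext i j
    rw [map_apply, of_apply, map_add, hE', map_mul, Ideal.Quotient.eq_zero_iff_mem.2
      (Ideal.mem_span_singleton_self d), mul_zero, add_zero]

theorem IsWSU.isSelfDual {R : Type*} [CommRing R] (hR : IsWSU R 2) (hsr : StableRangeCondition R 4)
    {d : R} {P : Type*} [AddCommGroup P] [Module (R ⧸ Ideal.span {d}) P]
    (hP : IsRankOneTwoGenerated (R ⧸ Ideal.span {d}) P) : IsSelfDual (R ⧸ Ideal.span {d}) P := by
  obtain ⟨x, g, hg, hE⟩ := hP.exists_coordinates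
  obtain ⟨A, hA, hAE⟩ := hsr.exists_unimodular_lift hE
  obtain ⟨N, hN⟩ := hR A hA
  let π := Ideal.Quotient.mk (Ideal.span {d})
  have hAE : A.map π = Matrix.of fun i j => g (x j) i := hAE
  -- The dual is generated by the coordinate functionals of `g`, and evaluation at the `x j` is a
  -- section of that presentation; the resulting idempotent is the transpose.
  refine nonempty_linearEquiv_of_isSymm (f := Fintype.linearCombination _ x) (g := g)
    (f' := Fintype.linearCombination _ fun i => LinearMap.proj i ∘ₗ g)
    (g' := LinearMap.pi fun j => LinearMap.applyₗ (x j)) hg ?_ ?_ ?_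
    (N := N.val.map π) (N' := N⁻¹.val.map π) ?_ ?_ (E := A.map π)
  · intro v
    ext i
    rw [hAE]
    simp [Fintype.linearCombination_apply, mulVec, dotProduct, mul_comm]
  · intro q
    ext p
    conv_rhs => rw [← hg p]
    simp [Fintype.linearCombination_apply, mul_comm]
  · intro v
    ext i
    rw [hAE]
    simp [Fintype.linearCombination_apply, mulVec, dotProduct, mul_comm]
  · rw [← Matrix.map_mul, ← Units.val_mul, mul_inv_cancel, Units.val_one]
    simp
  · rw [← Matrix.map_mul, IsSymm, ← transpose_map, hN]

end SelfDual

/-! ### Rings in which every element is a square. -/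

theorem exists_sq_of_isIntegrallyClosed {R : Type*} [CommRing R] [IsDomain R]
    [IsIntegrallyClosed R] [IsAlgClosed (FractionRing R)] (x : R) : ∃ y : R, x = y ^ 2 := by
  obtain ⟨z, hz⟩ := IsAlgClosed.exists_pow_nat_eq (algebraMap R (FractionRing R) x) two_pos
  obtain ⟨y, rfl⟩ := IsIntegrallyClosed.exists_algebraMap_eq_of_isIntegral_pow two_pos
    (hz ▸ isIntegral_algebraMap (R := R) (x := x))
  exact ⟨y, IsFractionRing.injective R (FractionRing R) (by rw [map_pow, hz])⟩

theorem exists_sq_of_perfectRing {R : Type*} [CommRing R] [CharP R 2] [PerfectRing R 2] (x : R) :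
    ∃ y : R, x = y ^ 2 := by
  obtain ⟨y, hy⟩ := (PerfectRing.bijective_frobenius (R := R) (p := 2)).2 x
  exact ⟨y, hy.symm⟩

end MatExt

theorem mainTheorem4 {R : Type*} [CommRing R] (hR : IsWSU R 2) :
    -- (1)
    (∀ a b c : R, IsUnimodular ![a, b] →
      IsBooleanGroup (CokerUpsilon a b c) ∧
      ∀ x : (R ⧸ Ideal.span {c})ˣ, x ^ 2 ∈ (upsilon a b c).range) ∧
    -- (2)
    (stableRange R ≤ 4 →
      ∀ (d : R) (P : Type*) [AddCommGroup P] [Module (R ⧸ Ideal.span {d}) P],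
        IsRankOneTwoGenerated (R ⧸ Ideal.span {d}) P →
          IsSelfDual (R ⧸ Ideal.span {d}) P) ∧
    -- (3)
    ((∀ x : R, ∃ y : R, x = y ^ 2) →
      IsUTwo R ∧ (IsHermiteRing R → IsElementaryDivisorRing R)) ∧
    -- the two classes of examples for the hypothesis of (3)
    (∀ [IsDomain R] [IsIntegrallyClosed R] [IsAlgClosed (FractionRing R)],
      ∀ x : R, ∃ y : R, x = y ^ 2) ∧
    (∀ [CharP R 2] [PerfectRing R 2], ∀ x : R, ∃ y : R, x = y ^ 2) := by
  refine ⟨fun a b c hab => ⟨isBooleanGroup_cokerUpsilon fun x => hR.sq_mem_range_upsilon hab x,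
      fun x => hR.sq_mem_range_upsilon hab x⟩, fun hsr d P _ _ hP =>
      hR.isSelfDual (stableRangeCondition_of_stableRange_le hsr) hP, fun hsq => ?_,
    exists_sq_of_isIntegrallyClosed, exists_sq_of_perfectRing⟩
  exact ⟨hR.isUTwo hsq, (hR.isUTwo hsq).isElementaryDivisorRing⟩
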